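/- Let $\mathcal V$ be a variety of algebras. For congruences $\alpha,\beta$ of an algebra $\mathbf A$, let $R(\alpha,\beta)=\{(a,b,c,d)\in A^4 : (a,b),(c,d)\in\alpha \text{ and } (a,c),(b,d)\in\beta\}$, a subalgebra of $\mathbf A^4$, and let $M(\alpha,\beta)$ be the subalgebra of $\mathbf A^4$ generated by the tuples $(c,d,c,d)$ with $(c,d)\in\alpha$ and $(a,a,c,c)$ with $(a,c)\in\beta$. Let $[\alpha,\beta]$ denote the commutator, that is, the least congruence $\delta$ of $\mathbf A$ such that $(b,d)\in\delta$ implies $(a,c)\in\delta$ for all $(a,b,c,d)\in M(\alpha,\beta)$, and let $0$ denote the equality relation. A *Kiss term* for $\mathcal V$ is a $4$-ary term $q(x,y,z,w)$ such that every member of $\mathcal V$ satisfies $q(x,x,y,y)\approx y$ and $q(x,y,x,y)\approx x$, and such that, for all $\mathbf A\in\mathcal V$, all congruences $\alpha,\beta$ of $\mathbf A$, and all $(a,b,c,d),(a,b,c',d)\in R(\alpha,\beta)$, the elements $q(a,b,c,d)$ and $q(a,b,c',d)$ are congruent modulo $[\alpha,\beta]$. Let $q$ be an arbitrary Kiss term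 for $\mathcal V$, let $\mathbf A\in\mathcal V$, and let $\alpha,\beta$ be congruences of $\mathbf A$. Then: (1) If $[\alpha,\beta]=0$, then $q\colon R(\alpha,\beta)\to\mathbf A$ is a homomorphism. (2) $[\alpha,\beta]=0$ if and only if both (i) $q\colon R(\alpha,\beta)\to\mathbf A$ is a homomorphism, and (ii) $q$ is independent of its third variable on $R(\alpha,\beta)$, i.e. $q(a,b,c,d)=q(a,b,c',d)$ whenever $(a,b,c,d),(a,b,c',d)\in R(\alpha,\beta)$. -/

import Mathlib

universe u v w

namespace KissTerm

open FirstOrder FirstOrder.Language.Structure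

variable {L : FirstOrder.Language.{u, v}}

/-- The direct power `A ^ ι`, with coordinatewise operations. -/
instance powStructure {ι : Type*} {A : Type*} [L.Structure A] : L.Structure (ι → A) where
  funMap f x := fun i => funMap f (fun k => x k i)
  RelMap r x := ∀ i, RelMap r (fun k => x k i)

/-- A variety is given by a set `E` of identities `s ≈ t` between terms in countably many variables;
`InVariety E A` says that the algebra `A` satisfies all of them. -/
def InVariety (E : Set (L.Term ℕ × L.Term ℕ)) (A : Type*) [L.Structure A] : Prop :=
  ∀ e ∈ E, ∀ x : ℕ → A, e.1.realize x = e.2.realize x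

variable (L) in
/-- A congruence of an algebra `A`: an equivalence relation preserved by all basic operations. -/
structure Congruence (A : Type w) [L.Structure A] extends Setoid A where
  map_rel : ∀ {n : ℕ} (f : L.Functions n) (x y : Fin n → A),
    (∀ i, r (x i) (y i)) → r (funMap f x) (funMap f y)

section Algebra

variable {A : Type w} [L.Structure A]

/-- The zero congruence, that is, equality. -/
instance : Bot (Congruence L A) where
  bot :=
    { r := fun a b => a = b
      iseqv := ⟨fun _ => rfl, fun h => h.symm, fun h h' => h.trans h'⟩
      map_rel := fun f _ _ h => congrArg (funMap f) (funext h) }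

/-- `R(α, β)` as a subalgebra of `A ^ 4`. The tuple `(a, b, c, d)` stands for the matrix with rows
`(a, c)` and `(b, d)`; its columns are in `α` and its rows are in `β`. -/
def R (α β : Congruence L A) : L.Substructure (Fin 4 → A) where
  carrier := {m | α.r (m 0) (m 1) ∧ α.r (m 2) (m 3) ∧ β.r (m 0) (m 2) ∧ β.r (m 1) (m 3)}
  fun_mem := fun f _ hx =>
    ⟨α.map_rel f _ _ fun i => (hx i).1, α.map_rel f _ _ fun i => (hx i).2.1,
      β.map_rel f _ _ fun i => (hx i).2.2.1, β.map_rel f _ _ fun i => (hx i).2.2.2⟩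

/-- `M(α, β)`: the subalgebra of `A ^ 4` generated by the matrices with both columns equal to
`(c, d) ∈ α` and the matrices with both rows equal to `(a, c) ∈ β`. -/
def M (α β : Congruence L A) : L.Substructure (Fin 4 → A) :=
  FirstOrder.Language.Substructure.closure L
    ({m | ∃ c d, α.r c d ∧ m = ![c, d, c, d]} ∪ {m | ∃ a c, β.r a c ∧ m = ![a, a, c, c]})

/-- `α` centralizes `β` modulo `δ` (the term condition): in every matrix of `M(α, β)`, if the
bottom row is in `δ` then so is the top row. -/
def Centralizes (α β δ : Congruence L A) : Prop :=
  ∀ m ∈ M α β, δ.r (m 1) (m 3) → δ.r (m 0) (m 2)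

/-- The commutator `[α, β]`: the least congruence `δ` such that `α` centralizes `β` modulo `δ`,
constructed as the intersection of all of them. -/
def commutator (α β : Congruence L A) : Congruence L A where
  r a b := ∀ δ : Congruence L A, Centralizes α β δ → δ.r a b
  iseqv := ⟨fun a δ _ => δ.iseqv.refl a, fun h δ hδ => δ.iseqv.symm (h δ hδ),
    fun h h' δ hδ => δ.iseqv.trans (h δ hδ) (h' δ hδ)⟩
  map_rel := fun f x y h δ hδ => δ.map_rel f x y fun i => h i δ hδ

/-- The intersection defining `[α, β]` is itself one of the congruences being intersected. -/
theorem centralizes_commutator (α β : Congruence L A) : Centralizes α β (commutator α β) :=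
  fun m hm h δ hδ => hδ m hm (h δ hδ)

/-- The map `(a, b, c, d) ↦ q(a, b, c, d)` is a homomorphism from `R(α, β)` to `A`. -/
def IsHomOnR (q : L.Term (Fin 4)) (α β : Congruence L A) : Prop :=
  ∃ φ : (R α β) →[L] A, ∀ m : R α β, φ m = q.realize (m : Fin 4 → A)

/-- `q` does not depend on its third variable on `R(α, β)`. -/
def IndepThirdOnR (q : L.Term (Fin 4)) (α β : Congruence L A) : Prop :=
  ∀ a b c c' d : A, ![a, b, c, d] ∈ R α β → ![a, b, c', d] ∈ R α β →
    q.realize ![a, b, c, d] = q.realize ![a, b, c', d]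

end Algebra

/-- `q` is a Kiss term (a 4-ary difference term) for the variety axiomatized by `E`. -/
structure IsKissTerm (E : Set (L.Term ℕ × L.Term ℕ)) (q : L.Term (Fin 4)) : Prop where
  left_identity : ∀ (A : Type w) [L.Structure A], InVariety E A →
    ∀ x y : A, q.realize ![x, x, y, y] = y
  right_identity : ∀ (A : Type w) [L.Structure A], InVariety E A →
    ∀ x y : A, q.realize ![x, y, x, y] = x
  third_variable : ∀ (A : Type w) [L.Structure A], InVariety E A →
    ∀ (α β : Congruence L A) (a b c c' d : A),
      ![a, b, c, d] ∈ R α β → ![a, b, c', d] ∈ R α β →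
        (commutator α β).r (q.realize ![a, b, c, d]) (q.realize ![a, b, c', d])

end KissTerm

/-! If `q` is a homomorphism on `R α β`, then on `M α β` it equals the third projection, since it
does so on the generators; independence of the third variable then gives the term condition modulo
`⊥` (`centralizes_bot_of_isHomOnR`).

For the other direction, assume `[α, β] = 0` and close `M α β` under horizontal and vertical
composition of matrices, obtaining a subalgebra `S`. The Maltsev behaviour of `q` on blocks of `α ∧
β` keeps every stage rigid, so an entry `c` in `![a, b, c, d] ∈ S` is determined by the other three
(`third_entry`). It remains to see that `q` computes this entry: `![a, b, q(a,b,c,d), d] ∈ S` for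
every matrix of `R α β` (`realize_mem`). As `S` is a subalgebra, `q` is then a homomorphism.

For `realize_mem`, `S` is viewed as a congruence on the algebra of pairs `α`. In the quotient, which
lies in the variety, two congruences induced by `β` have zero commutator (`centralizes_quot`), so
the independence axiom for `q` applies there. -/

namespace KissTerm

open FirstOrder FirstOrder.Language FirstOrder.Language.Structure

/-! ### Terms and maps preserving operations -/

section Terms

variable {L : FirstOrder.Language.{u, v}}

/-- Maps commuting with the basic operations commute with term operations. -/
theorem realize_map {A B γ : Type*} [L.Structure A] [L.Structure B] (φ : A → B)
    (hφ : ∀ {n : ℕ} (f : L.Functions n) (x : Fin n → A),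
      φ (funMap f x) = funMap f (fun i => φ (x i)))
    (t : L.Term γ) (x : γ → A) :
    φ (t.realize x) = t.realize (fun k => φ (x k)) := by
  induction t with
  | var k => rfl
  | func f ts ih =>
    simp only [Term.realize_func]
    rw [hφ]
    exact congrArg (funMap f) (funext ih)

end Terms

/-! ### Subalgebras of matrices, their compositions, and rigidity -/

section Matrices

variable {L : FirstOrder.Language.{u, v}} {A : Type w} [L.Structure A]

theorem Congruence.refl (θ : Congruence L A) (a : A) : θ.r a a := θ.iseqv.refl a

theorem Congruence.symm (θ : Congruence L A) {a b : A} (h : θ.r a b) : θ.r b a := θ.iseqv.symm h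

theorem Congruence.trans (θ : Congruence L A) {a b c : A} (h : θ.r a b) (h' : θ.r b c) :
    θ.r a c := θ.iseqv.trans h h'

theorem Congruence.ext_rel {θ θ' : Congruence L A} (h : ∀ a b, θ.r a b ↔ θ'.r a b) : θ = θ' := by
  obtain ⟨s, hs⟩ := θ
  obtain ⟨s', hs'⟩ := θ'
  obtain rfl : s = s' := Setoid.ext h
  rfl

theorem commutator_eq_bot_iff {α β : Congruence L A} :
    commutator α β = ⊥ ↔ Centralizes α β ⊥ := by
  refine ⟨fun h => h ▸ centralizes_commutator α β, fun h => Congruence.ext_rel fun a b => ?_⟩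
  refine ⟨fun hab => hab ⊥ h, fun hab => ?_⟩
  obtain rfl : a = b := hab
  exact Congruence.refl _ a

theorem vec4_eta (m : Fin 4 → A) : ![m 0, m 1, m 2, m 3] = m := by
  ext i; fin_cases i <;> rfl

theorem funMap_vec4 {n : ℕ} (f : L.Functions n) (a b c d : Fin n → A) :
    funMap f (fun k => ![a k, b k, c k, d k]) =
      ![funMap f a, funMap f b, funMap f c, funMap f d] := by
  ext i; fin_cases i <;> rfl

theorem funMap_vec4_mem (S : L.Substructure (Fin 4 → A)) {n : ℕ} (f : L.Functions n)
    {a b c d : Fin n → A} (h : ∀ k, ![a k, b k, c k, d k] ∈ S) :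
    ![funMap f a, funMap f b, funMap f c, funMap f d] ∈ S :=
  funMap_vec4 f a b c d ▸ S.fun_mem f _ h

theorem realize_pow {ι γ : Type*} (t : L.Term γ) (x : γ → ι → A) (i : ι) :
    t.realize x i = t.realize (fun k => x k i) :=
  realize_map (fun y : ι → A => y i) (fun _ _ => rfl) t x

theorem realize_vec4_mem (S : L.Substructure (Fin 4 → A)) {γ : Type*} (t : L.Term γ)
    {a b c d : γ → A} (h : ∀ k, ![a k, b k, c k, d k] ∈ S) :
    ![t.realize a, t.realize b, t.realize c, t.realize d] ∈ S := by
  have key := t.realize_mem (S := S) (fun k => ![a k, b k, c k, d k]) h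
  rw [← vec4_eta (t.realize _)] at key
  rwa [realize_pow, realize_pow, realize_pow, realize_pow] at key

variable {α β : Congruence L A}

theorem mem_R {a b c d : A} :
    ![a, b, c, d] ∈ R α β ↔ α.r a b ∧ α.r c d ∧ β.r a c ∧ β.r b d := Iff.rfl

theorem col_mem_M {a b : A} (h : α.r a b) : ![a, b, a, b] ∈ M α β :=
  Substructure.subset_closure (Or.inl ⟨a, b, h, rfl⟩)

theorem row_mem_M {a c : A} (h : β.r a c) : ![a, a, c, c] ∈ M α β :=
  Substructure.subset_closure (Or.inr ⟨a, c, h, rfl⟩)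

theorem M_le {S : L.Substructure (Fin 4 → A)} (h₁ : ∀ a b, α.r a b → ![a, b, a, b] ∈ S)
    (h₂ : ∀ a c, β.r a c → ![a, a, c, c] ∈ S) : M α β ≤ S := by
  refine Substructure.closure_le.2 ?_
  rintro m (⟨a, b, h, rfl⟩ | ⟨a, c, h, rfl⟩)
  exacts [h₁ a b h, h₂ a c h]

theorem M_le_R : M α β ≤ R α β :=
  M_le (fun a b h => ⟨h, h, β.refl a, β.refl b⟩) (fun a c h => ⟨α.refl a, α.refl c, h, h⟩)

/-- The set of matrices whose image under a permutation of the entries lies in `S`. -/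
def permute (σ : Fin 4 → Fin 4) (S : L.Substructure (Fin 4 → A)) :
    L.Substructure (Fin 4 → A) where
  carrier := {m | (fun i => m (σ i)) ∈ S}
  fun_mem := fun f x hx => S.fun_mem f (fun k i => x k (σ i)) hx

theorem mem_permute {σ : Fin 4 → Fin 4} {S : L.Substructure (Fin 4 → A)} {m : Fin 4 → A} :
    m ∈ permute σ S ↔ ![m (σ 0), m (σ 1), m (σ 2), m (σ 3)] ∈ S := by
  rw [vec4_eta (fun i => m (σ i))]; rfl

theorem M_swap_columns {a b c d : A} (h : ![a, b, c, d] ∈ M α β) : ![c, d, a, b] ∈ M α β := by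
  have : M α β ≤ permute ![2, 3, 0, 1] (M α β) :=
    M_le (fun a b h => mem_permute.2 (col_mem_M h))
      (fun a c h => mem_permute.2 (row_mem_M (β.symm h)))
  exact mem_permute.1 (this h)

theorem M_swap_rows {a b c d : A} (h : ![a, b, c, d] ∈ M α β) : ![b, a, d, c] ∈ M α β := by
  have : M α β ≤ permute ![1, 0, 3, 2] (M α β) :=
    M_le (fun a b h => mem_permute.2 (col_mem_M (α.symm h)))
      (fun a c h => mem_permute.2 (row_mem_M h))
  exact mem_permute.1 (this h)

/-- Matrices obtained by stacking two matrices of `S` with a common row. -/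
def stackRows (S : L.Substructure (Fin 4 → A)) : L.Substructure (Fin 4 → A) where
  carrier := {m | ∃ e f, ![m 0, e, m 2, f] ∈ S ∧ ![e, m 1, f, m 3] ∈ S}
  fun_mem := fun g x hx => by
    choose e f h₁ h₂ using hx
    exact ⟨funMap g e, funMap g f, funMap_vec4_mem S g h₁, funMap_vec4_mem S g h₂⟩

/-- Matrices obtained by placing side by side two matrices of `S` with a common column. -/
def joinColumns (S : L.Substructure (Fin 4 → A)) : L.Substructure (Fin 4 → A) where
  carrier := {m | ∃ e f, ![m 0, m 1, e, f] ∈ S ∧ ![e, f, m 2, m 3] ∈ S}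
  fun_mem := fun g x hx => by
    choose e f h₁ h₂ using hx
    exact ⟨funMap g e, funMap g f, funMap_vec4_mem S g h₁, funMap_vec4_mem S g h₂⟩

theorem mem_stackRows {S : L.Substructure (Fin 4 → A)} {a b c d : A} :
    ![a, b, c, d] ∈ stackRows S ↔ ∃ e f, ![a, e, c, f] ∈ S ∧ ![e, b, f, d] ∈ S := Iff.rfl

theorem mem_joinColumns {S : L.Substructure (Fin 4 → A)} {a b c d : A} :
    ![a, b, c, d] ∈ joinColumns S ↔ ∃ e f, ![a, b, e, f] ∈ S ∧ ![e, f, c, d] ∈ S := Iff.rfl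

/-- A subalgebra between `M(α, β)` and `R(α, β)`, closed under interchanging the two columns, in
which a matrix with three equal entries `c` has fourth entry `c` too. -/
structure IsRigid (α β : Congruence L A) (S : L.Substructure (Fin 4 → A)) : Prop where
  M_le : M α β ≤ S
  le_R : S ≤ R α β
  swap : ∀ {a b c d}, ![a, b, c, d] ∈ S → ![c, d, a, b] ∈ S
  rigid : ∀ {a c}, ![a, c, c, c] ∈ S → a = c

/-- The conditions on a term `q` that are used on a single algebra with `[α, β] = 0`. -/
structure IsKissOn (q : L.Term (Fin 4)) (α β : Congruence L A) : Prop where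
  left : ∀ x y : A, q.realize ![x, x, y, y] = y
  right : ∀ x y : A, q.realize ![x, y, x, y] = x
  indep : IndepThirdOnR q α β

theorem const_mem {S : L.Substructure (Fin 4 → A)} (hS : M α β ≤ S) (c : A) :
    ![c, c, c, c] ∈ S := hS (col_mem_M (α.refl c))

theorem isRigid_M (h : Centralizes α β ⊥) : IsRigid α β (M α β) where
  M_le := le_rfl
  le_R := M_le_R
  swap := M_swap_columns
  rigid := fun hm => h _ hm rfl

theorem IsRigid.le_stackRows {S : L.Substructure (Fin 4 → A)} (hS : IsRigid α β S) :
    S ≤ stackRows S := fun m hm =>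
  ⟨m 1, m 3, (vec4_eta m).symm ▸ hm, hS.M_le (row_mem_M (hS.le_R hm).2.2.2)⟩

theorem IsRigid.le_joinColumns {S : L.Substructure (Fin 4 → A)} (hS : IsRigid α β S) :
    S ≤ joinColumns S := fun m hm =>
  ⟨m 2, m 3, (vec4_eta m).symm ▸ hm, hS.M_le (col_mem_M (hS.le_R hm).2.1)⟩

/-- A subalgebra of `A ^ 4` is closed under `q(x, y, z, z)` applied entrywise. -/
theorem maltsev_mem {q : L.Term (Fin 4)} {S : L.Substructure (Fin 4 → A)} {a b c d a' b' c' d' a'' b'' c'' d'' : A}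
    (h : ![a, b, c, d] ∈ S) (h' : ![a', b', c', d'] ∈ S) (h'' : ![a'', b'', c'', d''] ∈ S) :
    ![q.realize ![a, a', a'', a''], q.realize ![b, b', b'', b''],
      q.realize ![c, c', c'', c''], q.realize ![d, d', d'', d''] ] ∈ S := by
  refine realize_vec4_mem S q fun k => ?_
  fin_cases k
  exacts [h, h', h'', h'']

namespace IsKissOn

variable {q : L.Term (Fin 4)}

/-- `q(x, y, z, z)` is a Maltsev operation on the blocks of `α ∧ β`. -/
theorem maltsev_right (hq : IsKissOn q α β) {x y : A} (h₁ : α.r x y) (h₂ : β.r x y) : q.realize ![x, y, y, y] = x :=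
  (hq.indep x y y x y ⟨h₁, α.refl y, h₂, β.refl y⟩ ⟨h₁, h₁, β.refl x, β.refl y⟩).trans
    (hq.right x y)

/-- Applying `q(x, y, z, z)` to the given matrix, `![c, b, c, b]` and the constant `c` yields `![a,
c, c, c]`, which rigidity handles. The next two lemmas use the same reduction. -/
theorem top_row (hq : IsKissOn q α β) {S : L.Substructure (Fin 4 → A)} (hS : IsRigid α β S) {a b c : A}
    (h : ![a, b, c, b] ∈ S) : a = c := by
  obtain ⟨hab, hcb, hac, -⟩ := mem_R.1 (hS.le_R h)
  have key := maltsev_mem (q := q) h (hS.M_le (col_mem_M (β := β) hcb)) (const_mem hS.M_le c)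
  rw [hq.maltsev_right (α.trans hab (α.symm hcb)) hac, hq.left, hq.left] at key
  exact hS.rigid key

theorem left_column (hq : IsKissOn q α β) {S : L.Substructure (Fin 4 → A)} (hS : IsRigid α β S) {a b c : A}
    (h : ![a, b, c, c] ∈ S) : a = b := by
  obtain ⟨hab, -, hac, hbc⟩ := mem_R.1 (hS.le_R h)
  have key := maltsev_mem (q := q) h (hS.M_le (row_mem_M (α := α) hbc)) (const_mem hS.M_le b)
  rw [hq.maltsev_right hab (β.trans hac (β.symm hbc)), hq.left, hq.left] at key
  exact hS.rigid key

theorem third_entry (hq : IsKissOn q α β) {S : L.Substructure (Fin 4 → A)} (hS : IsRigid α β S) {a b c c' d : A}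
    (h : ![a, b, c, d] ∈ S) (h' : ![a, b, c', d] ∈ S) : c = c' := by
  obtain ⟨-, hcd, hac, -⟩ := mem_R.1 (hS.le_R h)
  obtain ⟨-, hcd', hac', -⟩ := mem_R.1 (hS.le_R h')
  have key := maltsev_mem (q := q) h h' (const_mem hS.M_le c')
  rw [hq.left, hq.left, hq.left,
    hq.maltsev_right (α.trans hcd (α.symm hcd')) (β.trans (β.symm hac) hac')] at key
  exact hS.rigid (hS.swap key)

/-- When a stacked matrix has three entries `c`, `top_row` collapses the shared row to an equality,
and a second use collapses the top row. For `joinColumns`, `left_column` plays this role. -/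
theorem isRigid_stackRows (hq : IsKissOn q α β) {S : L.Substructure (Fin 4 → A)} (hS : IsRigid α β S) :
    IsRigid α β (stackRows S) where
  M_le := M_le (fun _ b h => mem_stackRows.2 ⟨b, b, hS.M_le (col_mem_M h), const_mem hS.M_le b⟩)
    (fun a c h => mem_stackRows.2 ⟨a, c, hS.M_le (row_mem_M h), hS.M_le (row_mem_M h)⟩)
  le_R := by
    rintro m ⟨e, f, h₁, h₂⟩
    obtain ⟨a₁, a₂, a₃, -⟩ := hS.le_R h₁
    obtain ⟨b₁, b₂, -, b₄⟩ := hS.le_R h₂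
    exact ⟨α.trans a₁ b₁, α.trans a₂ b₂, a₃, b₄⟩
  swap := fun ⟨e, f, h₁, h₂⟩ => ⟨f, e, hS.swap h₁, hS.swap h₂⟩
  rigid := fun h => by
    obtain ⟨e, f, h₁, h₂⟩ := mem_stackRows.1 h
    obtain rfl := hq.top_row hS h₂
    exact hq.top_row hS h₁

theorem isRigid_joinColumns (hq : IsKissOn q α β) {S : L.Substructure (Fin 4 → A)} (hS : IsRigid α β S) :
    IsRigid α β (joinColumns S) where
  M_le := M_le (fun a b h => mem_joinColumns.2 ⟨a, b, hS.M_le (col_mem_M h),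
      hS.M_le (col_mem_M h)⟩)
    (fun _ c h => mem_joinColumns.2 ⟨c, c, hS.M_le (row_mem_M h), const_mem hS.M_le c⟩)
  le_R := by
    rintro m ⟨e, f, h₁, h₂⟩
    obtain ⟨a₁, -, a₃, a₄⟩ := hS.le_R h₁
    obtain ⟨-, b₂, b₃, b₄⟩ := hS.le_R h₂
    exact ⟨a₁, b₂, β.trans a₃ b₃, β.trans a₄ b₄⟩
  swap := fun ⟨e, f, h₁, h₂⟩ => ⟨e, f, hS.swap h₂, hS.swap h₁⟩
  rigid := fun h => by
    obtain ⟨e, f, h₁, h₂⟩ := mem_joinColumns.1 h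
    obtain rfl := hq.left_column hS h₂
    exact hq.left_column hS h₁

/-- If `[α, β] = 0`, the closure of `M(α, β)` under both compositions of matrices is rigid. -/
theorem exists_isRigid_closed (hq : IsKissOn q α β) (h : Centralizes α β ⊥) :
    ∃ S, IsRigid α β S ∧ stackRows S ≤ S ∧ joinColumns S ≤ S := by
  -- The two compositions alternate. Degenerate matrices in `M α β` make the stages increase, so
  -- their union is closed under both; rigidity concerns one matrix, hence passes to the union.
  let T : ℕ → L.Substructure (Fin 4 → A) :=
    fun n => (fun S => joinColumns (stackRows S))^[n] (M α β)
  have succ (n : ℕ) : T (n + 1) = joinColumns (stackRows (T n)) :=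
    Function.iterate_succ_apply' _ _ _
  have hT (n : ℕ) : IsRigid α β (T n) := by
    induction n with
    | zero => exact isRigid_M h
    | succ n ih => exact succ n ▸ hq.isRigid_joinColumns (hq.isRigid_stackRows ih)
  have stack_le (n : ℕ) : stackRows (T n) ≤ T (n + 1) :=
    succ n ▸ (hq.isRigid_stackRows (hT n)).le_joinColumns
  have mono : Monotone T :=
    monotone_nat_of_le_succ fun n => ((hT n).le_stackRows).trans (stack_le n)
  have mem {m : Fin 4 → A} : m ∈ iSup T ↔ ∃ n, m ∈ T n :=
    Substructure.mem_iSup_of_directed mono.directed_le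
  have mem₂ {m m' : Fin 4 → A} (h₁ : m ∈ iSup T) (h₂ : m' ∈ iSup T) :
      ∃ n, m ∈ T n ∧ m' ∈ T n := by
    obtain ⟨i, hi⟩ := mem.1 h₁
    obtain ⟨j, hj⟩ := mem.1 h₂
    exact ⟨max i j, mono (le_max_left i j) hi, mono (le_max_right i j) hj⟩
  refine ⟨iSup T, ⟨le_iSup T 0, iSup_le fun n => (hT n).le_R, fun hm => ?_, fun hm => ?_⟩, ?_, ?_⟩
  · obtain ⟨n, hn⟩ := mem.1 hm
    exact mem.2 ⟨n, (hT n).swap hn⟩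
  · obtain ⟨n, hn⟩ := mem.1 hm
    exact (hT n).rigid hn
  · rintro m ⟨e, f, h₁, h₂⟩
    obtain ⟨n, h₁, h₂⟩ := mem₂ h₁ h₂
    exact mem.2 ⟨n + 1, stack_le n ⟨e, f, h₁, h₂⟩⟩
  · rintro m ⟨e, f, h₁, h₂⟩
    obtain ⟨n, h₁, h₂⟩ := mem₂ h₁ h₂
    refine mem.2 ⟨n + 1, succ n ▸ ?_⟩
    exact ⟨e, f, (hT n).le_stackRows h₁, (hT n).le_stackRows h₂⟩

end IsKissOn

/-- If `q` is a homomorphism on `R(α, β)`, then it is the third projection on `M(α, β)`. -/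
theorem realize_eq_third_of_mem_M {q : L.Term (Fin 4)}
    (left : ∀ x y : A, q.realize ![x, x, y, y] = y)
    (right : ∀ x y : A, q.realize ![x, y, x, y] = x)
    (hom : IsHomOnR q α β) {m : Fin 4 → A} (hm : m ∈ M α β) : q.realize m = m 2 := by
  obtain ⟨φ, hφ⟩ := hom
  let S : L.Substructure (Fin 4 → A) :=
    { carrier := {m | m ∈ R α β ∧ q.realize m = m 2}
      fun_mem := fun {n} f x hx => by
        refine ⟨(R α β).fun_mem f x fun i => (hx i).1, ?_⟩
        have key := φ.map_fun f fun i => (⟨x i, (hx i).1⟩ : R α β)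
        rw [hφ] at key
        refine key.trans (congrArg (funMap f) (funext fun i => ?_))
        exact (hφ _).trans (hx i).2 }
  have hS : M α β ≤ S := M_le
    (fun a b h => ⟨M_le_R (col_mem_M h), right a b⟩)
    (fun a c h => ⟨M_le_R (row_mem_M h), left a c⟩)
  exact (hS hm).2

theorem centralizes_bot_of_isHomOnR {q : L.Term (Fin 4)}
    (left : ∀ x y : A, q.realize ![x, x, y, y] = y)
    (right : ∀ x y : A, q.realize ![x, y, x, y] = x)
    (hom : IsHomOnR q α β) (indep : IndepThirdOnR q α β) : Centralizes α β ⊥ := by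
  intro m hm hrow
  have hrow : m 1 = m 3 := hrow
  have hR := M_le_R hm
  have h₁ := realize_eq_third_of_mem_M left right hom hm
  -- With equal bottom entries, the third entry may be replaced by `m 0`, giving a matrix with equal
  -- columns, where `q` returns `m 0`.
  have h₂ := indep (m 0) (m 1) (m 2) (m 0) (m 3) hR
    ⟨hR.1, hrow ▸ hR.1, β.refl _, hR.2.2.2⟩
  rw [vec4_eta, h₁, ← hrow, right] at h₂
  exact h₂.symm

end Matrices

/-! ### Quotient algebras and induced congruences -/

section Quotients

variable {L : FirstOrder.Language.{u, v}} {A : Type w} [L.Structure A]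

/-- The quotient of an algebra by a congruence. -/
def Congruence.Quot (θ : Congruence L A) : Type w := Quotient θ.toSetoid

/-- The class of an element modulo a congruence. -/
def Congruence.cls (θ : Congruence L A) (a : A) : θ.Quot := Quotient.mk θ.toSetoid a

/-- A representative of a class modulo a congruence. -/
noncomputable def Congruence.rep (θ : Congruence L A) (x : θ.Quot) : A := Quotient.out x

theorem Congruence.cls_rep (θ : Congruence L A) (x : θ.Quot) : θ.cls (θ.rep x) = x :=
  Quotient.out_eq x

theorem Congruence.cls_eq_cls (θ : Congruence L A) {a b : A} : θ.cls a = θ.cls b ↔ θ.r a b :=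
  Quotient.eq

theorem Congruence.rep_cls (θ : Congruence L A) (a : A) : θ.r (θ.rep (θ.cls a)) a :=
  θ.cls_eq_cls.1 (θ.cls_rep _)

noncomputable instance (θ : Congruence L A) : L.Structure θ.Quot where
  funMap f x := θ.cls (funMap f fun i => θ.rep (x i))
  -- An arbitrary choice: only the operations enter into terms and congruences.
  RelMap _ _ := False

theorem Congruence.cls_funMap (θ : Congruence L A) {n : ℕ} (f : L.Functions n) (x : Fin n → A) :
    θ.cls (funMap f x) = funMap f fun i => θ.cls (x i) :=
  θ.cls_eq_cls.2 (θ.map_rel f _ _ fun i => θ.symm (θ.rep_cls (x i)))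

theorem Congruence.cls_realize (θ : Congruence L A) {γ : Type*} (t : L.Term γ) (x : γ → A) :
    θ.cls (t.realize x) = t.realize fun k => θ.cls (x k) :=
  realize_map θ.cls θ.cls_funMap t x

theorem InVariety.quot {E : Set (L.Term ℕ × L.Term ℕ)} (h : InVariety E A) (θ : Congruence L A) :
    InVariety E θ.Quot := by
  intro e he x
  obtain ⟨y, rfl⟩ : ∃ y : ℕ → A, (fun k => θ.cls (y k)) = x :=
    ⟨fun k => θ.rep (x k), funext fun k => θ.cls_rep _⟩
  rw [← θ.cls_realize, ← θ.cls_realize, h e he y]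

/-- The image in the quotient by `θ` of a congruence above `θ`. -/
def Congruence.descend (θ ψ : Congruence L A) (h : ∀ a b, θ.r a b → ψ.r a b) :
    Congruence L θ.Quot where
  r x y := ψ.r (θ.rep x) (θ.rep y)
  iseqv := ⟨fun _ => ψ.refl _, fun h => ψ.symm h, fun h h' => ψ.trans h h'⟩
  map_rel := fun f _ _ hxy => ψ.trans (h _ _ (θ.rep_cls _))
    (ψ.trans (ψ.map_rel f _ _ hxy) (ψ.symm (h _ _ (θ.rep_cls _))))

theorem Congruence.descend_cls {θ ψ : Congruence L A} {h : ∀ a b, θ.r a b → ψ.r a b} {a b : A} :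
    (θ.descend ψ h).r (θ.cls a) (θ.cls b) ↔ ψ.r a b :=
  ⟨fun hab => ψ.trans (ψ.symm (h _ _ (θ.rep_cls a))) (ψ.trans hab (h _ _ (θ.rep_cls b))),
    fun hab => ψ.trans (h _ _ (θ.rep_cls a)) (ψ.trans hab (ψ.symm (h _ _ (θ.rep_cls b))))⟩

end Quotients

/-! ### The algebra of pairs, modulo column equivalence -/

section Columns

variable {L : FirstOrder.Language.{u, v}} {A : Type w} [L.Structure A]

/-- A congruence `α` regarded as an algebra of pairs, a subalgebra of the square. -/
def Congruence.Pairs (α : Congruence L A) : Type w := {p : A × A // α.r p.1 p.2}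

variable {α β : Congruence L A}

/-- The first coordinate of a pair. -/
def Congruence.Pairs.fst (x : α.Pairs) : A := x.1.1

/-- The second coordinate of a pair. -/
def Congruence.Pairs.snd (x : α.Pairs) : A := x.1.2

theorem Congruence.Pairs.rel (x : α.Pairs) : α.r x.fst x.snd := x.2

theorem Congruence.Pairs.ext {x y : α.Pairs} (h₁ : x.fst = y.fst) (h₂ : x.snd = y.snd) : x = y :=
  Subtype.ext (Prod.ext h₁ h₂)

/-- The pair `(a, b)`. -/
def Congruence.pair (α : Congruence L A) {a b : A} (h : α.r a b) : α.Pairs := ⟨(a, b), h⟩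

instance : L.Structure α.Pairs where
  funMap f x := α.pair (α.map_rel f (fun i => (x i).fst) (fun i => (x i).snd) fun i => (x i).rel)
  RelMap _ _ := False

theorem Congruence.Pairs.fst_realize {γ : Type*} (t : L.Term γ) (x : γ → α.Pairs) :
    (t.realize x).fst = t.realize fun k => (x k).fst :=
  realize_map Congruence.Pairs.fst (fun _ _ => rfl) t x

theorem Congruence.Pairs.snd_realize {γ : Type*} (t : L.Term γ) (x : γ → α.Pairs) :
    (t.realize x).snd = t.realize fun k => (x k).snd :=
  realize_map Congruence.Pairs.snd (fun _ _ => rfl) t x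

theorem InVariety.pairs {E : Set (L.Term ℕ × L.Term ℕ)} (h : InVariety E A) (α : Congruence L A) :
    InVariety E α.Pairs := by
  intro e he x
  apply Congruence.Pairs.ext
  · rw [Congruence.Pairs.fst_realize, Congruence.Pairs.fst_realize, h e he]
  · rw [Congruence.Pairs.snd_realize, Congruence.Pairs.snd_realize, h e he]

/-- The congruence on the pairs of `α` given by `β` in the second coordinate. -/
def sndRel (α β : Congruence L A) : Congruence L α.Pairs where
  r x y := β.r x.snd y.snd
  iseqv := ⟨fun _ => β.refl _, fun h => β.symm h, fun h h' => β.trans h h'⟩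
  map_rel := fun f _ _ h => β.map_rel f _ _ h

/-- The congruence on the pairs of `α` given by `β` in both coordinates. -/
def bothRel (α β : Congruence L A) : Congruence L α.Pairs where
  r x y := β.r x.fst y.fst ∧ β.r x.snd y.snd
  iseqv := ⟨fun _ => ⟨β.refl _, β.refl _⟩, fun h => ⟨β.symm h.1, β.symm h.2⟩,
    fun h h' => ⟨β.trans h.1 h'.1, β.trans h.2 h'.2⟩⟩
  map_rel := fun f _ _ h =>
    ⟨β.map_rel f _ _ fun i => (h i).1, β.map_rel f _ _ fun i => (h i).2⟩

/-- A rigid set of matrices closed under joining columns is a congruence on the pairs of `α`. -/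
def columnRel {S : L.Substructure (Fin 4 → A)} (hS : IsRigid α β S) (hj : joinColumns S ≤ S) :
    Congruence L α.Pairs where
  r x y := ![x.fst, x.snd, y.fst, y.snd] ∈ S
  iseqv := ⟨fun x => hS.M_le (col_mem_M x.rel), fun h => hS.swap h,
    fun h h' => hj (mem_joinColumns.2 ⟨_, _, h, h'⟩)⟩
  map_rel := fun f _ _ h => funMap_vec4_mem S f h

variable {S : L.Substructure (Fin 4 → A)}

theorem bothRel_of_columnRel {hS : IsRigid α β S} {hj : joinColumns S ≤ S} (x y : α.Pairs)
    (h : (columnRel hS hj).r x y) : (bothRel α β).r x y := (hS.le_R h).2.2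

theorem sndRel_of_columnRel {hS : IsRigid α β S} {hj : joinColumns S ≤ S} (x y : α.Pairs)
    (h : (columnRel hS hj).r x y) : (sndRel α β).r x y := (hS.le_R h).2.2.2

/-- Four pairs `x, x', y, y'` such that the matrices `(x, y)` and `(x', y')` are linked by
matrices of `M(α, β)`. -/
def Linked (β : Congruence L A) (x x' y y' : α.Pairs) : Prop :=
  ∃ e f e' f', ![x.fst, e, y.fst, f] ∈ M α β ∧ ![x'.fst, e', y'.fst, f'] ∈ M α β ∧
    ![e, x.snd, e', x'.snd] ∈ M α β ∧ ![f, y.snd, f', y'.snd] ∈ M α β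

theorem Linked.funMap {n : ℕ} (g : L.Functions n) {x x' y y' : Fin n → α.Pairs}
    (h : ∀ i, Linked β (x i) (x' i) (y i) (y' i)) :
    Linked β (funMap g x) (funMap g x') (funMap g y) (funMap g y') := by
  choose e f e' f' h₁ h₂ h₃ h₄ using h
  exact ⟨Structure.funMap g e, Structure.funMap g f, Structure.funMap g e', Structure.funMap g f',
    funMap_vec4_mem _ g h₁, funMap_vec4_mem _ g h₂, funMap_vec4_mem _ g h₃, funMap_vec4_mem _ g h₄⟩

/-- The linking matrices are the other faces of a prism: gluing them around the matrix of `x', y'`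
by the two compositions produces the matrix of `x, y`. -/
theorem Linked.mem_of_mem (hS : IsRigid α β S) (hs : stackRows S ≤ S) (hj : joinColumns S ≤ S)
    {x x' y y' : α.Pairs} (h : Linked β x x' y y')
    (h' : ![x'.fst, x'.snd, y'.fst, y'.snd] ∈ S) : ![x.fst, x.snd, y.fst, y.snd] ∈ S := by
  obtain ⟨e, f, e', f', h₁, h₂, h₃, h₄⟩ := h
  have k₁ : ![e', x'.snd, f', y'.snd] ∈ S :=
    hs (mem_stackRows.2 ⟨_, _, hS.M_le (M_swap_rows h₂), h'⟩)
  have k₂ : ![e, x.snd, f', y'.snd] ∈ S := hj (mem_joinColumns.2 ⟨_, _, hS.M_le h₃, k₁⟩)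
  have k₃ : ![e, x.snd, f, y.snd] ∈ S :=
    hj (mem_joinColumns.2 ⟨_, _, k₂, hS.M_le (M_swap_columns h₄)⟩)
  exact hs (mem_stackRows.2 ⟨_, _, hS.M_le h₁, k₃⟩)

/-- Modulo the congruence given by `S`, the commutator of `sndRel` and `bothRel` is zero. -/
theorem centralizes_quot (hS : IsRigid α β S) (hs : stackRows S ≤ S) (hj : joinColumns S ≤ S) :
    Centralizes ((columnRel hS hj).descend (sndRel α β) sndRel_of_columnRel)
      ((columnRel hS hj).descend (bothRel α β) bothRel_of_columnRel) ⊥ := by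
  set θ := columnRel hS hj
  let W : L.Substructure (Fin 4 → θ.Quot) :=
    { carrier := {m | ∃ x x' y y', Linked β x x' y y' ∧
        θ.cls x = m 0 ∧ θ.cls x' = m 1 ∧ θ.cls y = m 2 ∧ θ.cls y' = m 3}
      fun_mem := fun g m hm => by
        choose x x' y y' h h₀ h₁ h₂ h₃ using hm
        refine ⟨_, _, _, _, Linked.funMap g h, ?_, ?_, ?_, ?_⟩
        · exact (θ.cls_funMap g x).trans (congrArg (funMap g) (funext h₀))
        · exact (θ.cls_funMap g x').trans (congrArg (funMap g) (funext h₁))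
        · exact (θ.cls_funMap g y).trans (congrArg (funMap g) (funext h₂))
        · exact (θ.cls_funMap g y').trans (congrArg (funMap g) (funext h₃)) }
  have hW : M (θ.descend (sndRel α β) sndRel_of_columnRel)
      (θ.descend (bothRel α β) bothRel_of_columnRel) ≤ W := by
    -- For a generator with equal columns the intermediate entries are second coordinates; for one
    -- with equal rows they are first coordinates.
    refine M_le (fun u v h => ?_) (fun u v h => ?_)
    · exact ⟨θ.rep u, θ.rep v, θ.rep u, θ.rep v,
        ⟨_, _, _, _, col_mem_M (θ.rep u).rel, col_mem_M (θ.rep v).rel, row_mem_M h, row_mem_M h⟩,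
        θ.cls_rep _, θ.cls_rep _, θ.cls_rep _, θ.cls_rep _⟩
    · exact ⟨θ.rep u, θ.rep u, θ.rep v, θ.rep v,
        ⟨_, _, _, _, row_mem_M h.1, row_mem_M h.1, col_mem_M (θ.rep u).rel,
          col_mem_M (θ.rep v).rel⟩,
        θ.cls_rep _, θ.cls_rep _, θ.cls_rep _, θ.cls_rep _⟩
  intro m hm hrow
  obtain ⟨x, x', y, y', h, h₀, h₁, h₂, h₃⟩ := hW hm
  have hrow : m 1 = m 3 := hrow
  rw [← h₁, ← h₃, θ.cls_eq_cls] at hrow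
  change m 0 = m 2
  rw [← h₀, ← h₂, θ.cls_eq_cls]
  exact h.mem_of_mem hS hs hj hrow

end Columns

/-! ### Kiss terms as homomorphisms -/

section Main

variable {L : FirstOrder.Language.{u, v}} {E : Set (L.Term ℕ × L.Term ℕ)} {q : L.Term (Fin 4)}
  {A : Type w} [L.Structure A] {α β : Congruence L A}

theorem IsKissTerm.isKissOn (hq : IsKissTerm.{u, v, w} E q) (hA : InVariety E A)
    (h : commutator α β = ⊥) : IsKissOn q α β where
  left := hq.left_identity A hA
  right := hq.right_identity A hA
  indep := fun a b c c' d h₁ h₂ => by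
    have key := hq.third_variable A hA α β a b c c' d h₁ h₂
    rwa [h] at key

/-- Replacing the third entry of a matrix of `R(α, β)` by the value of a Kiss term gives a matrix
of every rigid set that is closed under both compositions. -/
theorem IsKissTerm.realize_mem (hq : IsKissTerm.{u, v, w} E q) (hA : InVariety E A)
    {S : L.Substructure (Fin 4 → A)} (hS : IsRigid α β S) (hs : stackRows S ≤ S)
    (hj : joinColumns S ≤ S) {a b c d : A} (h : ![a, b, c, d] ∈ R α β) :
    ![a, b, q.realize ![a, b, c, d], d] ∈ S := by
  obtain ⟨hab, hcd, hac, hbd⟩ := mem_R.1 h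
  set θ := columnRel hS hj
  have hQ : InVariety E θ.Quot := (hA.pairs α).quot θ
  have hkiss := hq.isKissOn hQ (commutator_eq_bot_iff.2 (centralizes_quot hS hs hj))
  let x := α.pair hab
  let y := α.pair hcd
  let z := α.pair (α.refl b)
  let z' := α.pair (α.refl d)
  have hz : θ.cls z = θ.cls z' := θ.cls_eq_cls.2 (hS.M_le (row_mem_M hbd))
  -- In the quotient `z = z'`, so `q(x, z, y, z') = q(x, z, x, z) = x`. Coordinatewise the left side
  -- is `(q(a,b,c,d), q(b,b,d,d))`, whose second entry is `d`.
  have key := hkiss.indep (θ.cls x) (θ.cls z) (θ.cls y) (θ.cls x) (θ.cls z)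
    ⟨Congruence.descend_cls.2 (β.refl b), Congruence.descend_cls.2 (β.symm hbd),
      Congruence.descend_cls.2 ⟨hac, hbd⟩, Congruence.refl _ _⟩
    ⟨Congruence.descend_cls.2 (β.refl b), Congruence.descend_cls.2 (β.refl b),
      Congruence.refl _ _, Congruence.refl _ _⟩
  have hvec : ![θ.cls x, θ.cls z, θ.cls y, θ.cls z'] = fun k => θ.cls (![x, z, y, z'] k) := by
    ext k; fin_cases k <;> rfl
  have hfst : (fun k => (![x, z, y, z'] k).fst) = ![a, b, c, d] := by
    ext k; fin_cases k <;> rfl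
  have hsnd : (fun k => (![x, z, y, z'] k).snd) = ![b, b, d, d] := by
    ext k; fin_cases k <;> rfl
  rw [hkiss.right] at key
  nth_rw 2 [hz] at key
  rw [hvec, ← θ.cls_realize, θ.cls_eq_cls] at key
  have key' := hS.swap key
  rwa [Congruence.Pairs.fst_realize, Congruence.Pairs.snd_realize, hfst, hsnd,
    hq.left_identity A hA] at key'

theorem IsKissTerm.isHomOnR [L.IsAlgebraic] (hq : IsKissTerm.{u, v, w} E q) (hA : InVariety E A)
    (h : commutator α β = ⊥) : IsHomOnR q α β := by
  have hkiss := hq.isKissOn hA h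
  obtain ⟨S, hS, hs, hj⟩ := hkiss.exists_isRigid_closed (commutator_eq_bot_iff.1 h)
  have hmem {m : Fin 4 → A} (hm : m ∈ R α β) : ![m 0, m 1, q.realize m, m 3] ∈ S := by
    have := hq.realize_mem hA hS hs hj (a := m 0) (b := m 1) (c := m 2) (d := m 3) hm
    rwa [vec4_eta] at this
  refine ⟨⟨fun m => q.realize (m : Fin 4 → A), fun {n} f x => ?_, fun r => isEmptyElim r⟩,
    fun m => rfl⟩
  -- Both sides of the homomorphism identity complete the same three entries to a matrix of `S`.
  exact hkiss.third_entry hS (hmem (funMap f x).2) (funMap_vec4_mem S f fun i => hmem (x i).2)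

end Main

end KissTerm

theorem corollary8p2 {L : FirstOrder.Language.{u, v}} [L.IsAlgebraic]
    (E : Set (L.Term ℕ × L.Term ℕ)) (q : L.Term (Fin 4)) (hq : KissTerm.IsKissTerm.{u, v, w} E q)
    (A : Type w) [L.Structure A] (hA : KissTerm.InVariety E A)
    (α β : KissTerm.Congruence L A) :
    (KissTerm.commutator α β = ⊥ → KissTerm.IsHomOnR q α β) ∧
    (KissTerm.commutator α β = ⊥ ↔
      KissTerm.IsHomOnR q α β ∧ KissTerm.IndepThirdOnR q α β) := by
  refine ⟨hq.isHomOnR hA, fun h => ⟨hq.isHomOnR hA h, (hq.isKissOn hA h).indep⟩, fun h => ?_⟩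
  exact KissTerm.commutator_eq_bot_iff.2 (KissTerm.centralizes_bot_of_isHomOnR
    (hq.left_identity A hA) (hq.right_identity A hA) h.1 h.2)
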